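/- Let $\widehat\Sigma=\langle\Sigma_c,\Sigma_r,\Sigma_i\rangle$ be a visibly pushdown alphabet, $\Sigma=\Sigma_c\sqcup\Sigma_r\sqcup\Sigma_i$ (calls, returns, internal letters). A visibly pushdown automaton $\mathcal A$ over $\widehat\Sigma$ has a finite state set $Q$, an initial state $q_0$, final states $F\subseteq Q$, a finite stack alphabet $\Gamma$ with bottom symbol $\bot\in\Gamma$, and a transition relation $\delta\subseteq (Q\times\Sigma_c\times Q\times(\Gamma\setminus\{\bot\}))\cup(Q\times\Sigma_r\times\Gamma\times Q)\cup(Q\times\Sigma_i\times Q)$: a call pushes a symbol, a return pops the top symbol (but leaves $\bot$ in place if $\bot$ is on the top), an internal letter does not touch the stack. $L(\mathcal A)$ is the set of words on which some computation from $q_0$ with stack $\bot$ ends in a state of $F$, with any stack. For a context-free grammar $G$ with nonterminals $V_N$ and a nonterminal $A$ let $\mathcal L_G(A)=\{a\in\Sigma: A\Rightarrow^* Ba\alpha\}$ and $\mathcal R_G(A)=\{a\in\Sigma: A\Rightarrow^*\alpha aB\}$, where $B\in V_N\cup\{\varepsilon\}$ and $\alpha\in(V_N\cup\Sigma)^*$.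 The precedence matrix $OPM(G)$ assigns to $(a,b)\in\Sigma^2$ the set of those of the following relations that hold: $a\doteq b$ if there is a rule $A\to\alpha aBb\beta$ with $B\in V_N\cup\{\varepsilon\}$; $a\gtrdot b$ if there is a rule $A\to\alpha Db\beta$ with $D\in V_N$ and $a\in\mathcal R_G(D)$; $a\lessdot b$ if there is a rule $A\to\alpha aD\beta$ with $D\in V_N$ and $b\in\mathcal L_G(D)$. A matrix is conflict-free if every entry has at most one element. $G$ is a Floyd (operator precedence) grammar if no right part of a rule has two adjacent nonterminals and $OPM(G)$ is conflict-free. The total VP matrix $M_T$ of $\widehat\Sigma$ has the entries $M_T[a,b]=\{\lessdot\}$ for $a\in\Sigma_c$, $b\in\Sigma_c\cup\Sigma_i$; $M_T[a,b]=\{\doteq\}$ for $a\in\Sigma_c$, $b\in\Sigma_r$; and $M_T[a,b]=\{\gtrdot\}$ for $a\in\Sigma_r\cup\Sigma_i$, $b\in\Sigma$. **Theorem.** There is an algorithm that, given any visibly pushdown automaton $\mathcal A$, produces a Floyd grammar $G$ such that $L(G)=L(\mathcal A)$ and such that the (conflict-free) matrix $OPM(G)$ is contained entrywise in $M_T$.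 Moreover, the nonterminals of $G$ can be divided into four classes $S,Y,B,Z$, with the axiom in class $S$, such that every rule of $G$ has one of the forms $$S\to \varepsilon \mid Y \mid [Y]\,c\,[Z],\qquad Y\to [Y]\,s\mid [Y]\,r\mid [Y]\,c\,[B]\,r,$$ $$B\to [B]\,s\mid [B]\,c\,[B]\,r,\qquad Z\to [B]\,s\mid [B]\,c\,[B]\,r\mid [B]\,c\,[Z],$$ where a class name stands for some nonterminal of that class, brackets mark an optional nonterminal, and $c\in\Sigma_c$, $r\in\Sigma_r$, $s\in\Sigma_i$. Thus $G$ follows the factorization of a word $x$ as $x=y$ or $x=y\,c_0\,z$, where $c_0\in\Sigma_c$, $y=u_1w_1\cdots u_kw_k$ with $u_j\in(\Sigma_r\cup\Sigma_i)^*$ and $w_j$ empty or well-closed (well-balanced, beginning with a call and ending with a return), and $z=v_1c_1v_2c_2\cdots c_{m-1}v_m$ with $c_j\in\Sigma_c$ and $v_j$ empty or well-balanced (every call is matched by a return and conversely). -/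

import Mathlib

namespace VPFloyd

/-! ### Visibly pushdown automata -/

/-- A visibly pushdown alphabet: the disjoint union of the calls `C`, the returns `R` and the
internal letters `I`. -/
abbrev Letter (C R I : Type) : Type := C ⊕ R ⊕ I

/-- The letter given by a call. -/
abbrev call {C R I : Type} (c : C) : Letter C R I := Sum.inl c

/-- The letter given by a return. -/
abbrev ret {C R I : Type} (r : R) : Letter C R I := Sum.inr (Sum.inl r)

/-- The letter given by an internal letter. -/
abbrev internal {C R I : Type} (s : I) : Letter C R I := Sum.inr (Sum.inr s)

/-- A (nondeterministic) visibly pushdown automaton with calls `C`, returns `R`, internal letters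
`I`, states `Q` and stack symbols `Γ`, where `Γ` does not contain the bottom symbol `⊥`.  In a
return transition `none : Option Γ` stands for `⊥` and `some Z` for `Z`.

The transition relation and the set of final states are finite sets, written as lists (order and
repetitions are irrelevant), so that an automaton is a finite object that an algorithm can read. -/
structure VPDA (C R I Q Γ : Type) where
  /-- The initial state. -/
  init : Q
  /-- The final states. -/
  final : List Q
  /-- Transitions `(q, c, q', Z)`: read the call `c` and push `Z`. -/
  callTrans : List (Q × C × Q × Γ)
  /-- Transitions `(q, r, X, q')`: read the return `r` with `X` on the top of the stack. -/
  retTrans : List (Q × R × Option Γ × Q)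
  /-- Transitions `(q, s, q')`: read the internal letter `s`. -/
  intTrans : List (Q × I × Q)

namespace VPDA

variable {C R I Q Γ : Type}

/-- One move.  A configuration is a state with the stack, top first and without the bottom symbol,
so that `[]` is the stack that consists of `⊥` alone.  A return that is read with `⊥` on the top
leaves `⊥` where it is. -/
inductive Step (A : VPDA C R I Q Γ) : Q × List Γ → Letter C R I → Q × List Γ → Prop
  | call {q q' : Q} {c : C} {Z : Γ} (σ : List Γ) (h : (q, c, q', Z) ∈ A.callTrans) :
      Step A (q, σ) (call c) (q', Z :: σ)
  | pop {q q' : Q} {r : R} {Z : Γ} (σ : List Γ) (h : (q, r, some Z, q') ∈ A.retTrans) :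
      Step A (q, Z :: σ) (ret r) (q', σ)
  | bottom {q q' : Q} {r : R} (h : (q, r, none, q') ∈ A.retTrans) :
      Step A (q, []) (ret r) (q', [])
  | internal {q q' : Q} {s : I} (σ : List Γ) (h : (q, s, q') ∈ A.intTrans) :
      Step A (q, σ) (internal s) (q', σ)

/-- `A.Run κ w κ'`: some computation that reads `w` leads from `κ` to `κ'`. -/
inductive Run (A : VPDA C R I Q Γ) : Q × List Γ → List (Letter C R I) → Q × List Γ → Prop
  | nil (κ : Q × List Γ) : Run A κ [] κ
  | cons {κ κ' κ'' : Q × List Γ} {a : Letter C R I} {w : List (Letter C R I)}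
      (h : A.Step κ a κ') (t : Run A κ' w κ'') : Run A κ (a :: w) κ''

/-- The language recognized by final state, with any stack at the end. -/
def language (A : VPDA C R I Q Γ) : Language (Letter C R I) :=
  {w | ∃ q ∈ A.final, ∃ σ : List Γ, A.Run (A.init, []) w (q, σ)}

/-- An automaton is the tuple of its five components. -/
def equivTuple : VPDA C R I Q Γ ≃
    Q × List Q × List (Q × C × Q × Γ) × List (Q × R × Option Γ × Q) × List (Q × I × Q) where
  toFun A := (A.init, A.final, A.callTrans, A.retTrans, A.intTrans)
  invFun t := ⟨t.1, t.2.1, t.2.2.1, t.2.2.2.1, t.2.2.2.2⟩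
  left_inv _ := rfl
  right_inv _ := rfl

/-- Automata as inputs of algorithms: the encoding is that of the tuple of components. -/
instance instPrimcodable [Primcodable C] [Primcodable R] [Primcodable I] [Primcodable Q]
    [Primcodable Γ] : Primcodable (VPDA C R I Q Γ) :=
  Primcodable.ofEquiv _ equivTuple

end VPDA

/-! ### Operator precedence -/

/-- The three operator precedence relations `⋖`, `≐`, `⋗`. -/
inductive Prec
  | lt
  | eq
  | gt

/-- A precedence matrix over `T`: each pair of letters is given a set of relations.  Containment
`M₁ ≤ M₂` of matrices is entrywise inclusion. -/
abbrev PrecMatrix (T : Type) : Type := T → T → Set Prec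

/-- A matrix is conflict-free if every entry has at most one element. -/
def PrecMatrix.ConflictFree {T : Type} (M : PrecMatrix T) : Prop :=
  ∀ a b : T, (M a b).Subsingleton

/-- The string that consists of one nonterminal or is empty. -/
def opt {T N : Type} : Option N → List (Symbol T N)
  | none => []
  | some B => [Symbol.nonterminal B]

section Grammar

variable {T : Type}

/-- An operator grammar: no right part has two adjacent nonterminals. -/
def IsOperatorGrammar (G : ContextFreeGrammar T) : Prop :=
  ∀ ρ ∈ G.rules, ∀ (α β : List (Symbol T G.NT)) (A B : G.NT),
    ρ.output ≠ α ++ Symbol.nonterminal A :: Symbol.nonterminal B :: β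

/-- The left terminal set: the `a` with `A ⇒* B a α`, `B` a nonterminal or empty. -/
def leftSet (G : ContextFreeGrammar T) (A : G.NT) : Set T :=
  {a | ∃ (B : Option G.NT) (α : List (Symbol T G.NT)),
    G.Derives [Symbol.nonterminal A] (opt B ++ Symbol.terminal a :: α)}

/-- The right terminal set: the `a` with `A ⇒* α a B`, `B` a nonterminal or empty. -/
def rightSet (G : ContextFreeGrammar T) (A : G.NT) : Set T :=
  {a | ∃ (B : Option G.NT) (α : List (Symbol T G.NT)),
    G.Derives [Symbol.nonterminal A] (α ++ Symbol.terminal a :: opt B)}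

/-- `a ≐ b`: there is a rule `A → α a B b β`, `B` a nonterminal or empty. -/
def EqPrec (G : ContextFreeGrammar T) (a b : T) : Prop :=
  ∃ ρ ∈ G.rules, ∃ (α β : List (Symbol T G.NT)) (B : Option G.NT),
    ρ.output = α ++ Symbol.terminal a :: (opt B ++ Symbol.terminal b :: β)

/-- `a ⋗ b`: there is a rule `A → α D b β` with `a` in the right terminal set of `D`. -/
def GtPrec (G : ContextFreeGrammar T) (a b : T) : Prop :=
  ∃ ρ ∈ G.rules, ∃ (α β : List (Symbol T G.NT)) (D : G.NT),
    ρ.output = α ++ Symbol.nonterminal D :: Symbol.terminal b :: β ∧ a ∈ rightSet G D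

/-- `a ⋖ b`: there is a rule `A → α a D β` with `b` in the left terminal set of `D`. -/
def LtPrec (G : ContextFreeGrammar T) (a b : T) : Prop :=
  ∃ ρ ∈ G.rules, ∃ (α β : List (Symbol T G.NT)) (D : G.NT),
    ρ.output = α ++ Symbol.terminal a :: Symbol.nonterminal D :: β ∧ b ∈ leftSet G D

/-- The operator precedence matrix of a grammar: all relations that hold between `a` and `b`. -/
def opm (G : ContextFreeGrammar T) : PrecMatrix T := fun a b =>
  {p | match p with
    | Prec.lt => LtPrec G a b
    | Prec.eq => EqPrec G a b
    | Prec.gt => GtPrec G a b}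

/-- A Floyd (operator precedence) grammar: an operator grammar whose precedence matrix is
conflict-free. -/
def IsFloydGrammar (G : ContextFreeGrammar T) : Prop :=
  IsOperatorGrammar G ∧ (opm G).ConflictFree

/-- Context-free grammars as outputs of algorithms: the axiom and the list of rules
`(left part, right part)`.  Nonterminals are natural numbers; in a right part `Sum.inl A` is the
nonterminal `A` and `Sum.inr a` the terminal `a`. -/
abbrev GrammarCode (T : Type) : Type := ℕ × List (ℕ × List (ℕ ⊕ T))

open Classical in
/-- The grammar that a code describes. -/
noncomputable def GrammarCode.toGrammar (g : GrammarCode T) : ContextFreeGrammar T where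
  NT := ℕ
  initial := g.1
  rules := (g.2.map fun ρ =>
    (⟨ρ.1, ρ.2.map (Sum.elim Symbol.nonterminal Symbol.terminal)⟩ :
      ContextFreeRule T ℕ)).toFinset

end Grammar

/-! ### The total VP matrix and the shape of the grammars -/

section VP

variable {C R I : Type}

/-- The total VP matrix `M_T` of the alphabet: a call is `⋖` every call and internal letter and
`≐` every return; returns and internal letters are `⋗` every letter. -/
def totalVPMatrix : PrecMatrix (Letter C R I)
  | Sum.inl _, Sum.inl _ => {Prec.lt}
  | Sum.inl _, Sum.inr (Sum.inl _) => {Prec.eq}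
  | Sum.inl _, Sum.inr (Sum.inr _) => {Prec.lt}
  | Sum.inr _, _ => {Prec.gt}

/-- The four classes of nonterminals: `S` for the axiom; `Y` for the strings
`u₁ w₁ u₂ w₂ … u_k w_k` with `u_j` made of returns and internal letters and `w_j` well-closed or
missing; `B` for the well-balanced strings; `Z` for the strings `v₁ c₁ v₂ c₂ … c_{m-1} v_m` with
calls `c_j` and with `v_j` well-balanced or empty. -/
inductive NTClass
  | S
  | Y
  | B
  | Z

/-- `RightPart κ X β`: `β` may be the right part of a rule whose left part has class `X`, when `κ`
gives the class of each nonterminal.  With `?` marking an optional nonterminal, `c` a call, `r` a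
return and `s` an internal letter, the rules are
`S → ε | Y | Y? c Z?`, `Y → Y? s | Y? r | Y? c B? r`, `B → B? s | B? c B? r` and
`Z → B? s | B? c B? r | B? c Z?`. -/
inductive RightPart {N : Type} (κ : N → NTClass) :
    NTClass → List (Symbol (Letter C R I) N) → Prop
  | S_empty : RightPart κ .S []
  | S_Y (y : N) (hy : κ y = .Y) : RightPart κ .S [Symbol.nonterminal y]
  | S_call (y z : Option N) (c : C) (hy : ∀ A ∈ y, κ A = .Y) (hz : ∀ A ∈ z, κ A = .Z) :
      RightPart κ .S (opt y ++ Symbol.terminal (call c) :: opt z)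
  | Y_internal (y : Option N) (s : I) (hy : ∀ A ∈ y, κ A = .Y) :
      RightPart κ .Y (opt y ++ [Symbol.terminal (internal s)])
  | Y_ret (y : Option N) (r : R) (hy : ∀ A ∈ y, κ A = .Y) :
      RightPart κ .Y (opt y ++ [Symbol.terminal (ret r)])
  | Y_call_ret (y b : Option N) (c : C) (r : R) (hy : ∀ A ∈ y, κ A = .Y)
      (hb : ∀ A ∈ b, κ A = .B) :
      RightPart κ .Y
        (opt y ++ Symbol.terminal (call c) :: (opt b ++ [Symbol.terminal (ret r)]))
  | B_internal (b : Option N) (s : I) (hb : ∀ A ∈ b, κ A = .B) :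
      RightPart κ .B (opt b ++ [Symbol.terminal (internal s)])
  | B_call_ret (b b' : Option N) (c : C) (r : R) (hb : ∀ A ∈ b, κ A = .B)
      (hb' : ∀ A ∈ b', κ A = .B) :
      RightPart κ .B
        (opt b ++ Symbol.terminal (call c) :: (opt b' ++ [Symbol.terminal (ret r)]))
  | Z_internal (b : Option N) (s : I) (hb : ∀ A ∈ b, κ A = .B) :
      RightPart κ .Z (opt b ++ [Symbol.terminal (internal s)])
  | Z_call_ret (b b' : Option N) (c : C) (r : R) (hb : ∀ A ∈ b, κ A = .B)
      (hb' : ∀ A ∈ b', κ A = .B) :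
      RightPart κ .Z
        (opt b ++ Symbol.terminal (call c) :: (opt b' ++ [Symbol.terminal (ret r)]))
  | Z_call (b z : Option N) (c : C) (hb : ∀ A ∈ b, κ A = .B) (hz : ∀ A ∈ z, κ A = .Z) :
      RightPart κ .Z (opt b ++ Symbol.terminal (call c) :: opt z)

/-- The grammar follows the factorization `x = y` or `x = y c₀ z` of the strings over a visibly
pushdown alphabet, where `c₀` is the first unmatched call: its nonterminals fall into the four
classes, and every rule has one of the forms listed for the class of its left part. -/
def FollowsFactorization (G : ContextFreeGrammar (Letter C R I)) : Prop :=
  ∃ κ : G.NT → NTClass, κ G.initial = .S ∧ ∀ ρ ∈ G.rules, RightPart κ (κ ρ.input) ρ.output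

end VP

end VPFloyd

/-! Cut a run at the calls that are never matched. The part before the first such call leads from
the bottom stack back to the bottom stack; each part after such a call is balanced and can be read
on every stack. Hence, besides the axiom, three kinds of nonterminals suffice: Y for strings from
the initial configuration to `(q, [])`, B for strings from `p` to `q` over an untouched stack, Z for
strings from `p` to acceptance. Y and B recurse at the left end; Z recurses to the right past
unmatched calls. No ε-rule is needed for these classes: an occurrence that would stand for the empty
string is left out (`Optional`).

The precedence relations depend only on the shape of the rules. A terminal just before a nonterminal
is a call, and that nonterminal is a B or a Z, whose left terminal set contains no return. A
terminal just after a nonterminal follows a Y or a B, whose right terminal set contains no call. Two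
terminals share a right part only in `c B? r`. So the matrix lies in `M_T` (`opm_le`), whose entries
are singletons.

For the language, call a family of languages closed if every rule maps it into itself. Runs of the
automaton form a closed family (`Rule.sound`), which therefore bounds the generated language
(`language_le_of_closed`). Conversely, every closed family contains the accepted words at the axiom
(`mem_of_mem_language`), and the generated languages are a closed family (`expand_yield_le`). The
rules are listed from the transition lists by primitive recursive operations. -/

namespace VPFloyd

/-! ### Bounds on left and right terminal sets -/

section Precedence

variable {T : Type} {G : ContextFreeGrammar T}

/-- If every right part of a nonterminal in `P` begins with an optional nonterminal in `P` and a
terminal in `K`, then the left terminal sets of the nonterminals in `P` are contained in `K`. -/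
theorem leftSet_subset (P : G.NT → Prop) (K : Set T)
    (h : ∀ ρ ∈ G.rules, P ρ.input → ∃ (b : Option G.NT) (a : T) (α : List (Symbol T G.NT)),
      ρ.output = opt b ++ Symbol.terminal a :: α ∧ (∀ n ∈ b, P n) ∧ a ∈ K)
    {D : G.NT} (hD : P D) : leftSet G D ⊆ K := by
  -- Invariant of derivations: after the first step, a form always begins with an optional
  -- nonterminal in `P` and a terminal in `K`.
  have key : ∀ u, G.Derives [Symbol.nonterminal D] u → u = [Symbol.nonterminal D] ∨
      ∃ (b : Option G.NT) (a : T) (α : List (Symbol T G.NT)),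
        u = opt b ++ Symbol.terminal a :: α ∧ (∀ n ∈ b, P n) ∧ a ∈ K := by
    intro u hu
    induction hu with
    | refl => exact Or.inl rfl
    | @tail v w _ hvw ih =>
      right
      obtain ⟨ρ, hρ, hr⟩ := hvw
      obtain ⟨p, q, rfl, rfl⟩ := hr.exists_parts
      rcases ih with ih | ⟨b, a, α, hu, hb, ha⟩
      · obtain ⟨rfl, hin, rfl⟩ : p = [] ∧ ρ.input = D ∧ q = [] := by
          cases p <;> simp_all
        obtain ⟨b, a, α, ho, hb, ha⟩ := h ρ hρ (hin ▸ hD)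
        exact ⟨b, a, α, by simp [ho], hb, ha⟩
      -- With `p` empty the leading nonterminal is rewritten and `h` gives a new beginning;
      -- otherwise the rewriting takes place behind the first terminal and the beginning survives.
      · rcases p with _ | ⟨x, p⟩
        · rcases b with _ | b
          · simp [opt] at hu
          · obtain ⟨rfl, rfl⟩ : ρ.input = b ∧ q = Symbol.terminal a :: α := by
              simpa [opt] using hu
            obtain ⟨b', a', α', ho, hb', ha'⟩ := h ρ hρ (hb _ rfl)
            exact ⟨b', a', α' ++ Symbol.terminal a :: α, by simp [ho], hb', ha'⟩
        · rcases b with _ | b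
          · obtain ⟨rfl, -⟩ : x = Symbol.terminal a ∧ _ := by simpa [opt] using hu
            exact ⟨none, a, p ++ ρ.output ++ q, by simp [opt], by simp, ha⟩
          · rcases p with _ | ⟨y, p⟩
            · simp [opt] at hu
            · obtain ⟨rfl, rfl, -⟩ :
                  x = Symbol.nonterminal b ∧ y = Symbol.terminal a ∧ _ := by
                simpa [opt] using hu
              exact ⟨some b, a, p ++ ρ.output ++ q, by simp [opt], hb, ha⟩
  rintro a ⟨B, α, hd⟩
  rcases key _ hd with hu | ⟨b, a', α', hu, -, ha'⟩
  · rcases B with _ | B <;> simp [opt] at hu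
  · rcases B with _ | B <;> rcases b with _ | b <;> simp [opt] at hu
    · exact hu.1 ▸ ha'
    · exact hu.2.1 ▸ ha'

theorem reverse_opt {N : Type} (b : Option N) : (opt b : List (Symbol T N)).reverse = opt b := by
  cases b <;> rfl

/-- If every right part of a nonterminal in `P` ends with a terminal in `K` and an optional
nonterminal in `P`, then the right terminal sets of the nonterminals in `P` are contained
in `K`. -/
theorem rightSet_subset (P : G.NT → Prop) (K : Set T)
    (h : ∀ ρ ∈ G.rules, P ρ.input → ∃ (b : Option G.NT) (a : T) (α : List (Symbol T G.NT)),
      ρ.output = α ++ Symbol.terminal a :: opt b ∧ (∀ n ∈ b, P n) ∧ a ∈ K)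
    {D : G.NT} (hD : P D) : rightSet G D ⊆ K := by
  rintro a ⟨B, α, hd⟩
  -- Right terminal sets are the left terminal sets of the reversed grammar.
  refine leftSet_subset (G := G.reverse) P K ?_ (D := D) hD ⟨B, α.reverse, ?_⟩
  · intro ρ hρ hP
    obtain ⟨ρ', hρ', rfl⟩ : ∃ ρ' ∈ G.rules, ρ'.reverse = ρ :=
      Finset.mem_map.1 hρ
    obtain ⟨b, a, α, ho, hb, ha⟩ := h ρ' hρ' hP
    refine ⟨b, a, α.reverse, ?_, hb, ha⟩
    show ρ'.output.reverse = _
    simp only [ho, List.reverse_append, List.reverse_cons, reverse_opt,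
      List.append_assoc, List.singleton_append]
    rfl
  · have := hd.reverse
    simp only [List.reverse_append, List.reverse_cons, reverse_opt, List.append_assoc,
      List.singleton_append, List.reverse_nil, List.nil_append] at this
    exact this

end Precedence

/-! ### From the shape of the rules to the precedence matrix -/

section Shape

variable {C R I : Type}

theorem totalVPMatrix_conflictFree :
    (totalVPMatrix : PrecMatrix (Letter C R I)).ConflictFree := by
  rintro (c | r | s) (c' | r' | s') <;> exact Set.subsingleton_singleton

theorem PrecMatrix.ConflictFree.anti {T : Type} {M M' : PrecMatrix T} (h : M'.ConflictFree)
    (hM : M ≤ M') : M.ConflictFree :=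
  fun a b => (h a b).anti (hM a b)

variable {N : Type} {κ : N → NTClass} {X : NTClass} {β : List (Symbol (Letter C R I) N)}

/-- The hypothesis of `leftSet_subset` for the classes that can follow a call. -/
theorem RightPart.exists_left (h : RightPart κ X β) (hX : X = .B ∨ X = .Z) :
    ∃ (b : Option N) (a : Letter C R I) (α : List (Symbol (Letter C R I) N)),
      β = opt b ++ Symbol.terminal a :: α ∧ (∀ n ∈ b, κ n = .B ∨ κ n = .Z) ∧
        a ∈ {a : Letter C R I | ∀ r, a ≠ ret r} := by
  cases h <;> simp at hX <;>
    exact ⟨_, _, _, rfl, fun n hn => Or.inl (by solve_by_elim), by simp⟩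

/-- The hypothesis of `rightSet_subset` for the classes that can precede a terminal. These right
parts all end in a terminal, so the optional nonterminal is always missing. -/
theorem RightPart.exists_right (h : RightPart κ X β) (hX : X = .Y ∨ X = .B) :
    ∃ (b : Option N) (a : Letter C R I) (α : List (Symbol (Letter C R I) N)),
      β = α ++ Symbol.terminal a :: opt b ∧ (∀ n ∈ b, κ n = .Y ∨ κ n = .B) ∧
        a ∈ {a : Letter C R I | ∀ c, a ≠ call c} := by
  cases h <;> simp at hX
  case Y_internal y s hy => exact ⟨none, internal s, opt y, rfl, by simp, by simp⟩
  case Y_ret y r hy => exact ⟨none, ret r, opt y, rfl, by simp, by simp⟩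
  case Y_call_ret y b c r hy hb =>
    exact ⟨none, ret r, opt y ++ Symbol.terminal (call c) :: opt b, by simp [opt], by simp,
      by simp⟩
  case B_internal y s hy => exact ⟨none, internal s, opt y, rfl, by simp, by simp⟩
  case B_call_ret y b c r hy hb =>
    exact ⟨none, ret r, opt y ++ Symbol.terminal (call c) :: opt b, by simp [opt], by simp,
      by simp⟩

/-- Two adjacent symbols of a right part. -/
theorem RightPart.adjacent (h : RightPart κ X β) {α γ : List (Symbol (Letter C R I) N)}
    {x y : Symbol (Letter C R I) N} (hβ : β = α ++ x :: y :: γ) :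
    (∃ D b, x = .nonterminal D ∧ y = .terminal b ∧ (κ D = .Y ∨ κ D = .B)) ∨
    (∃ c D, x = .terminal (call c) ∧ y = .nonterminal D ∧ (κ D = .B ∨ κ D = .Z)) ∨
    (∃ c r, x = .terminal (call c) ∧ y = .terminal (ret r)) := by
  cases h with
  | S_empty | S_Y => simp [List.cons_eq_append_iff] at hβ
  | S_call y z | Z_call y z | Y_call_ret y z | B_call_ret y z | Z_call_ret y z =>
    rcases y with _ | y <;> rcases z with _ | z <;>
      simp [opt, List.cons_eq_append_iff] at hβ <;> grind
  | Y_internal y | Y_ret y | B_internal y | Z_internal y =>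
    rcases y with _ | y <;> simp [opt, List.cons_eq_append_iff] at hβ; grind

/-- Only the forms that end in `c B? r` contain two terminals. -/
theorem RightPart.eq_call_ret (h : RightPart κ X β) {α γ : List (Symbol (Letter C R I) N)}
    {a b : Letter C R I} {B : Option N}
    (hβ : β = α ++ .terminal a :: (opt B ++ .terminal b :: γ)) :
    (∃ c, a = call c) ∧ ∃ r, b = ret r := by
  cases h with
  | S_empty | S_Y => simp [List.cons_eq_append_iff] at hβ
  | S_call y z | Z_call y z | Y_call_ret y z | B_call_ret y z | Z_call_ret y z =>
    rcases y with _ | y <;> rcases z with _ | z <;> rcases B with _ | B <;>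
      simp [opt, List.cons_eq_append_iff] at hβ <;> grind
  | Y_internal y | Y_ret y | B_internal y | Z_internal y =>
    rcases y with _ | y <;> rcases B with _ | B <;>
      simp [opt, List.cons_eq_append_iff] at hβ

variable {G : ContextFreeGrammar (Letter C R I)}

theorem FollowsFactorization.isOperatorGrammar (h : FollowsFactorization G) :
    IsOperatorGrammar G := by
  obtain ⟨κ, -, hκ⟩ := h
  intro ρ hρ α β A B ho
  rcases (hκ ρ hρ).adjacent ho with ⟨D, b, h1, h2, -⟩ | ⟨c, D, h1, h2, -⟩ | ⟨c, r, h1, h2⟩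
  · cases h2
  · cases h1
  · cases h1

/-- Adjacency fixes one side of each `⋖` and `⋗` by class: `⋖` starts at a call and reaches the left
set of a B or Z, `⋗` starts in the right set of a Y or B. -/
theorem FollowsFactorization.opm_le (h : FollowsFactorization G) :
    opm G ≤ totalVPMatrix := by
  obtain ⟨κ, -, hκ⟩ := h
  intro a b p hp
  rcases p with _ | _ | _
  · obtain ⟨ρ, hρ, α, β, D, ho, hb⟩ : LtPrec G a b := hp
    rcases (hκ ρ hρ).adjacent ho with ⟨_, _, h1, -, -⟩ | ⟨c, D', h1, h2, hD⟩ | ⟨_, _, -, h2⟩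
    · cases h1
    · cases h1
      cases h2
      have := leftSet_subset (fun n => κ n = .B ∨ κ n = .Z) _
        (fun ρ hρ hP => (hκ ρ hρ).exists_left hP) hD hb
      rcases b with c' | r | s
      · rfl
      · exact absurd rfl (this r)
      · rfl
    · cases h2
  · obtain ⟨ρ, hρ, α, β, D, ho⟩ : EqPrec G a b := hp
    obtain ⟨⟨c, rfl⟩, r, rfl⟩ := (hκ ρ hρ).eq_call_ret ho
    rfl
  · obtain ⟨ρ, hρ, α, β, D, ho, ha⟩ : GtPrec G a b := hp
    rcases (hκ ρ hρ).adjacent ho with ⟨D', b', h1, h2, hD⟩ | ⟨_, _, h1, -, -⟩ | ⟨_, _, h1, -⟩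
    · cases h1
      cases h2
      have := rightSet_subset (fun n => κ n = .Y ∨ κ n = .B) _
        (fun ρ hρ hP => (hκ ρ hρ).exists_right hP) hD ha
      rcases a with c' | a
      · exact absurd rfl (this c')
      · rfl
    · cases h1
    · cases h1

theorem FollowsFactorization.isFloydGrammar (h : FollowsFactorization G) : IsFloydGrammar G :=
  ⟨h.isOperatorGrammar, totalVPMatrix_conflictFree.anti h.opm_le⟩

end Shape

/-! ### Expansion of strings of symbols into languages -/

section Expand

variable {T N : Type}

/-- The words that arise from a string of symbols when each nonterminal `n` is replaced by some
word of `L n`. -/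
def expand (L : N → Language T) (u : List (Symbol T N)) : Language T :=
  (u.map fun
    | .terminal a => ({[a]} : Language T)
    | .nonterminal n => L n).prod

variable {L : N → Language T} {u v : List (Symbol T N)} {w : List T}

@[simp] theorem mem_expand_nil : w ∈ expand L [] ↔ w = [] := Iff.rfl

theorem expand_append : expand L (u ++ v) = expand L u * expand L v := by
  simp [expand]

theorem expand_singleton_nonterminal (n : N) : expand L [.nonterminal n] = L n := by
  simp [expand]

theorem mem_expand_append :
    w ∈ expand L (u ++ v) ↔ ∃ x ∈ expand L u, ∃ y ∈ expand L v, x ++ y = w := by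
  rw [expand_append, Language.mem_mul]

@[simp] theorem mem_expand_terminal_cons {a : T} :
    w ∈ expand L (.terminal a :: u) ↔ ∃ x ∈ expand L u, a :: x = w := by
  simp only [expand, List.map_cons, List.prod_cons, Language.mem_mul]
  constructor
  · rintro ⟨_, rfl, x, hx, rfl⟩
    exact ⟨x, hx, rfl⟩
  · rintro ⟨x, hx, rfl⟩
    exact ⟨_, rfl, x, hx, rfl⟩

theorem mem_expand_nonterminal_cons {n : N} :
    w ∈ expand L (.nonterminal n :: u) ↔ ∃ x ∈ L n, ∃ y ∈ expand L u, x ++ y = w := by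
  simp only [expand, List.map_cons, List.prod_cons, Language.mem_mul]

@[simp] theorem mem_expand_opt_some {n : N} : w ∈ expand L (opt (some n)) ↔ w ∈ L n := by
  rw [opt, expand_singleton_nonterminal]

theorem mem_expand_map_terminal : w ∈ expand L (w.map Symbol.terminal) := by
  induction w with
  | nil => simp
  | cons a w ih => simpa using ih

end Expand

/-! ### Families of languages closed under the rules -/

section Yield

variable {T : Type} {G : ContextFreeGrammar T}

/-- An assignment of languages to the nonterminals that is closed under the rules bounds the
language of the grammar. -/
theorem language_le_of_closed {L : G.NT → Language T}
    (h : ∀ ρ ∈ G.rules, expand L ρ.output ≤ L ρ.input) : G.language ≤ L G.initial := by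
  intro w hw
  have key : ∀ u, G.Derives [Symbol.nonterminal G.initial] u → expand L u ≤ L G.initial := by
    intro u hu
    induction hu with
    | refl => rw [expand_singleton_nonterminal]
    | tail _ hvw ih =>
      obtain ⟨ρ, hρ, hr⟩ := hvw
      obtain ⟨p, q, rfl, rfl⟩ := hr.exists_parts
      -- Expansion is a product of languages, hence monotone in each factor: replacing `ρ.input` by
      -- `ρ.output` in a fixed context can only shrink it.
      refine le_trans ?_ ih
      simp only [expand_append, expand_singleton_nonterminal]
      gcongr
      exact h ρ hρ
  exact key _ hw mem_expand_map_terminal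

/-- The language that a nonterminal generates. -/
def yield (G : ContextFreeGrammar T) (n : G.NT) : Language T :=
  {w | G.Derives [Symbol.nonterminal n] (w.map Symbol.terminal)}

theorem derives_of_mem_expand_yield {u : List (Symbol T G.NT)} {w : List T}
    (h : w ∈ expand (yield G) u) : G.Derives u (w.map Symbol.terminal) := by
  induction u generalizing w with
  | nil =>
    obtain rfl := mem_expand_nil.1 h
    exact .refl _
  | cons x u ih =>
    rcases x with a | n
    · obtain ⟨x, hx, rfl⟩ := mem_expand_terminal_cons.1 h
      exact (ih hx).append_left [Symbol.terminal a]
    · obtain ⟨x, hx, y, hy, rfl⟩ := mem_expand_nonterminal_cons.1 h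
      have h1 : G.Derives ([Symbol.nonterminal n] ++ u) (x.map Symbol.terminal ++ u) :=
        ContextFreeGrammar.Derives.append_right hx u
      rw [List.map_append]
      exact h1.trans ((ih hy).append_left _)

/-- The generated languages form a closed family, so a lower bound proved for all closed families
applies to the grammar. -/
theorem expand_yield_le {ρ : ContextFreeRule T G.NT} (hρ : ρ ∈ G.rules) :
    expand (yield G) ρ.output ≤ yield G ρ.input := fun _ hw =>
  ContextFreeGrammar.Produces.trans_derives ⟨ρ, hρ, ContextFreeRule.Rewrites.input_output⟩
    (derives_of_mem_expand_yield hw)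

end Yield

/-! ### Splitting runs at unmatched calls -/

namespace VPDA

variable {C R I Q Γ : Type} {A : VPDA C R I Q Γ}

theorem Run.append {κ κ' κ'' : Q × List Γ} {v w : List (Letter C R I)} (h : A.Run κ v κ')
    (h' : A.Run κ' w κ'') : A.Run κ (v ++ w) κ'' := by
  induction h with
  | nil => exact h'
  | cons hs _ ih => exact .cons hs (ih h')

theorem Step.run {κ κ' : Q × List Γ} {a : Letter C R I} (h : A.Step κ a κ') : A.Run κ [a] κ' :=
  .cons h (.nil _)

/-- `A.Balanced p w q`: the well-balanced or empty string `w` leads from `p` to `q`. -/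
inductive Balanced (A : VPDA C R I Q Γ) : Q → List (Letter C R I) → Q → Prop
  | nil (p : Q) : Balanced A p [] p
  | internal {p q q' : Q} {w : List (Letter C R I)} {s : I} (hw : Balanced A p w q)
      (h : (q, s, q') ∈ A.intTrans) : Balanced A p (w ++ [VPFloyd.internal s]) q'
  | call_ret {p q t t' q' : Q} {w v : List (Letter C R I)} {c : C} {r : R} {Z : Γ}
      (hw : Balanced A p w q) (hc : (q, c, t, Z) ∈ A.callTrans) (hv : Balanced A t v t')
      (hr : (t', r, some Z, q') ∈ A.retTrans) :
      Balanced A p (w ++ VPFloyd.call c :: (v ++ [ret r])) q'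

/-- A balanced string can be read on every stack, which it leaves unchanged. -/
theorem Balanced.run {p q : Q} {w : List (Letter C R I)} (h : A.Balanced p w q) (σ : List Γ) :
    A.Run (p, σ) w (q, σ) := by
  induction h generalizing σ with
  | nil => exact .nil _
  | internal _ h ih => exact (ih σ).append (Step.internal σ h).run
  | call_ret _ hc _ hr ih ih' =>
    exact (ih σ).append (.cons (.call σ hc) ((ih' _).append (Step.pop σ hr).run))

/-- `A.Level w q`: the string `w`, without unmatched calls, leads from the initial configuration
to `q` with the empty stack. -/
inductive Level (A : VPDA C R I Q Γ) : List (Letter C R I) → Q → Prop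
  | nil : Level A [] A.init
  | internal {q q' : Q} {w : List (Letter C R I)} {s : I} (hw : Level A w q)
      (h : (q, s, q') ∈ A.intTrans) : Level A (w ++ [VPFloyd.internal s]) q'
  | bottom {q q' : Q} {w : List (Letter C R I)} {r : R} (hw : Level A w q)
      (h : (q, r, none, q') ∈ A.retTrans) : Level A (w ++ [ret r]) q'
  | call_ret {q t t' q' : Q} {w v : List (Letter C R I)} {c : C} {r : R} {Z : Γ}
      (hw : Level A w q) (hc : (q, c, t, Z) ∈ A.callTrans) (hv : Balanced A t v t')
      (hr : (t', r, some Z, q') ∈ A.retTrans) :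
      Level A (w ++ VPFloyd.call c :: (v ++ [ret r])) q'

/-- `A.Pending w q σ`: the string `w`, split at its unmatched calls, leads from the initial
configuration to `(q, σ)`. -/
inductive Pending (A : VPDA C R I Q Γ) : List (Letter C R I) → Q → List Γ → Prop
  | level {w : List (Letter C R I)} {q : Q} (h : A.Level w q) : Pending A w q []
  | call {w v : List (Letter C R I)} {q p p' : Q} {σ : List Γ} {c : C} {Z : Γ}
      (hw : Pending A w q σ) (hc : (q, c, p, Z) ∈ A.callTrans) (hv : A.Balanced p v p') :
      Pending A (w ++ VPFloyd.call c :: v) p' (Z :: σ)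

/-- The essential case is a pop: it matches the last pending call, and that call, the balanced
string behind it and the return are absorbed as one segment into the part before the call. That part
is a level string or again the balanced tail of an earlier pending call. -/
theorem Pending.step {w : List (Letter C R I)} {κ κ' : Q × List Γ} {a : Letter C R I}
    (hw : A.Pending w κ.1 κ.2) (h : A.Step κ a κ') : A.Pending (w ++ [a]) κ'.1 κ'.2 := by
  cases h with
  | call σ h => exact .call hw h (.nil _)
  | pop σ h =>
    cases hw with
    | call hw hc hv =>
      cases hw with
      | level hw => simpa using Pending.level (hw.call_ret hc hv h)
      | call hw hc' hv' => simpa using Pending.call hw hc' (hv'.call_ret hc hv h)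
  | bottom h =>
    cases hw with
    | level hw => exact .level (hw.bottom h)
  | internal σ h =>
    cases hw with
    | level hw => exact .level (hw.internal h)
    | call hw hc hv => simpa using Pending.call hw hc (hv.internal h)

theorem Pending.run {v w : List (Letter C R I)} {κ κ' : Q × List Γ}
    (hv : A.Pending v κ.1 κ.2) (h : A.Run κ w κ') : A.Pending (v ++ w) κ'.1 κ'.2 := by
  induction h generalizing v with
  | nil => simpa using hv
  | cons hs _ ih => simpa using ih (hv.step hs)

/-- Every computation from the initial configuration splits at its unmatched calls. -/
theorem pending_of_run {w : List (Letter C R I)} {q : Q} {σ : List Γ}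
    (h : A.Run (A.init, []) w (q, σ)) : A.Pending w q σ :=
  Pending.run (v := []) (.level .nil) h

end VPDA

/-! ### Nonterminals, rules and soundness -/

section Construction

variable {C R I Q Γ : Type}

section Codes

variable [Primcodable Q]

variable (Q) in
/-- The code of the axiom. -/
def sCode : ℕ := Encodable.encode (none : Option (Q ⊕ (Q × Q) ⊕ Q))

/-- The code of the nonterminal of class `Y` for the strings that lead to `q`. -/
def yCode (q : Q) : ℕ := Encodable.encode (some (.inl q) : Option (Q ⊕ (Q × Q) ⊕ Q))

/-- The code of the nonterminal of class `B` for the strings that lead from `p` to `q`. -/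
def bCode (p q : Q) : ℕ :=
  Encodable.encode (some (.inr (.inl (p, q))) : Option (Q ⊕ (Q × Q) ⊕ Q))

/-- The code of the nonterminal of class `Z` for the strings that lead from `p` to a final
state. -/
def zCode (p : Q) : ℕ := Encodable.encode (some (.inr (.inr p)) : Option (Q ⊕ (Q × Q) ⊕ Q))

variable (Q) in
/-- The class of the nonterminal with a given code. -/
def classOf (n : ℕ) : NTClass :=
  match (Encodable.decode n : Option (Option (Q ⊕ (Q × Q) ⊕ Q))) with
  | some (some (.inl _)) => .Y
  | some (some (.inr (.inl _))) => .B
  | some (some (.inr (.inr _))) => .Z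
  -- The default covers the axiom and also numbers that code no nonterminal; the latter occur in no
  -- rule.
  | _ => .S

/-- The strings that the nonterminal with a given code stands for. -/
def meaning (A : VPDA C R I Q Γ) (n : ℕ) : Language (Letter C R I) :=
  match (Encodable.decode n : Option (Option (Q ⊕ (Q × Q) ⊕ Q))) with
  | some (some (.inl q)) => {w | A.Run (A.init, []) w (q, [])}
  | some (some (.inr (.inl (p, q)))) => {w | ∀ σ, A.Run (p, σ) w (q, σ)}
  | some (some (.inr (.inr p))) => {w | ∀ σ, ∃ q ∈ A.final, ∃ σ', A.Run (p, σ) w (q, σ')}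
  | _ => A.language

@[simp] theorem classOf_sCode : classOf Q (sCode Q) = .S := by simp [classOf, sCode]
@[simp] theorem classOf_yCode (q : Q) : classOf Q (yCode q) = .Y := by
  simp only [classOf, yCode, Encodable.encodek]

@[simp] theorem classOf_bCode (p q : Q) : classOf Q (bCode p q) = .B := by
  simp only [classOf, bCode, Encodable.encodek]

@[simp] theorem classOf_zCode (p : Q) : classOf Q (zCode p) = .Z := by
  simp only [classOf, zCode, Encodable.encodek]

variable (A : VPDA C R I Q Γ)

@[simp] theorem meaning_sCode : meaning A (sCode Q) = A.language := by simp [meaning, sCode]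

@[simp] theorem mem_meaning_yCode (q : Q) (w : List (Letter C R I)) :
    w ∈ meaning A (yCode q) ↔ A.Run (A.init, []) w (q, []) := by
  simp only [meaning, yCode, Encodable.encodek]; rfl

@[simp] theorem mem_meaning_bCode (p q : Q) (w : List (Letter C R I)) :
    w ∈ meaning A (bCode p q) ↔ ∀ σ, A.Run (p, σ) w (q, σ) := by
  simp only [meaning, bCode, Encodable.encodek]; rfl

@[simp] theorem mem_meaning_zCode (p : Q) (w : List (Letter C R I)) :
    w ∈ meaning A (zCode p) ↔ ∀ σ, ∃ q ∈ A.final, ∃ σ', A.Run (p, σ) w (q, σ') := by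
  simp only [meaning, zCode, Encodable.encodek]; rfl

end Codes

/-- An optional occurrence of the nonterminal `n`, which may be missing if `P` holds. -/
def Optional (n : ℕ) (P : Prop) (o : Option ℕ) : Prop :=
  o = some n ∨ o = none ∧ P

theorem Optional.class_eq {κ : ℕ → NTClass} {n : ℕ} {P : Prop} {o : Option ℕ} {X : NTClass}
    (h : Optional n P o) (hn : κ n = X) : ∀ m ∈ o, κ m = X := by
  rcases h with rfl | ⟨rfl, -⟩ <;> simp [hn]

theorem Optional.mem_expand {T : Type} {L : ℕ → Language T} {n : ℕ} {P : Prop} {o : Option ℕ}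
    {w : List T} (h : Optional n P o) (hw : w ∈ expand L (opt o)) : w ∈ L n ∨ w = [] ∧ P := by
  rcases h with rfl | ⟨rfl, hP⟩
  · exact .inl (mem_expand_opt_some.1 hw)
  · exact .inr ⟨hw, hP⟩

theorem exists_optional {T : Type} {L : ℕ → Language T} {n : ℕ} {P : Prop} {w : List T}
    (h : w ∈ L n ∨ w = [] ∧ P) : ∃ o, Optional n P o ∧ w ∈ expand L (opt o) := by
  rcases h with h | ⟨rfl, h⟩
  · exact ⟨some n, .inl rfl, mem_expand_opt_some.2 h⟩
  · exact ⟨none, .inr ⟨rfl, h⟩, rfl⟩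

variable [Primcodable Q]

/-- `Segment A q β q'`: the string `β` of one of the forms `s` and `c B? r` stands for strings
that lead from `q` to `q'` on every stack. -/
inductive Segment (A : VPDA C R I Q Γ) : Q → List (Symbol (Letter C R I) ℕ) → Q → Prop
  | internal {q q' : Q} {s : I} (h : (q, s, q') ∈ A.intTrans) :
      Segment A q [.terminal (internal s)] q'
  | call_ret {q p p' q' : Q} {c : C} {r : R} {Z : Γ} {b : Option ℕ}
      (hc : (q, c, p, Z) ∈ A.callTrans) (hr : (p', r, some Z, q') ∈ A.retTrans)
      (hb : Optional (bCode p p') (p = p') b) :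
      Segment A q (.terminal (call c) :: (opt b ++ [.terminal (ret r)])) q'

/-- The rules of the grammar of an automaton. -/
inductive Rule (A : VPDA C R I Q Γ) : ℕ → List (Symbol (Letter C R I) ℕ) → Prop
  | S_empty (h : A.init ∈ A.final) : Rule A (sCode Q) []
  | S_Y {q : Q} (h : q ∈ A.final) : Rule A (sCode Q) [.nonterminal (yCode q)]
  | S_call {q p : Q} {c : C} {Z : Γ} {y z : Option ℕ} (hc : (q, c, p, Z) ∈ A.callTrans)
      (hy : Optional (yCode q) (q = A.init) y) (hz : Optional (zCode p) (p ∈ A.final) z) :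
      Rule A (sCode Q) (opt y ++ .terminal (call c) :: opt z)
  | Y_segment {q q' : Q} {β : List (Symbol (Letter C R I) ℕ)} {y : Option ℕ}
      (hβ : Segment A q β q') (hy : Optional (yCode q) (q = A.init) y) :
      Rule A (yCode q') (opt y ++ β)
  | Y_ret {q q' : Q} {r : R} {y : Option ℕ} (hr : (q, r, none, q') ∈ A.retTrans)
      (hy : Optional (yCode q) (q = A.init) y) :
      Rule A (yCode q') (opt y ++ [.terminal (ret r)])
  | B_segment {o₀ o q q' : Q} {c : C} {Z : Γ} {β : List (Symbol (Letter C R I) ℕ)}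
      {b : Option ℕ} (ho : (o₀, c, o, Z) ∈ A.callTrans) (hβ : Segment A q β q')
      (hb : Optional (bCode o q) (o = q) b) :
      Rule A (bCode o q') (opt b ++ β)
  | Z_segment {o₀ o q q' : Q} {c : C} {Z : Γ} {β : List (Symbol (Letter C R I) ℕ)}
      {b : Option ℕ} (ho : (o₀, c, o, Z) ∈ A.callTrans) (hβ : Segment A q β q')
      (hq' : q' ∈ A.final) (hb : Optional (bCode o q) (o = q) b) :
      Rule A (zCode o) (opt b ++ β)
  | Z_call {o₀ o q p : Q} {c c' : C} {Z Z' : Γ} {b z : Option ℕ}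
      (ho : (o₀, c', o, Z') ∈ A.callTrans) (hc : (q, c, p, Z) ∈ A.callTrans)
      (hb : Optional (bCode o q) (o = q) b) (hz : Optional (zCode p) (p ∈ A.final) z) :
      Rule A (zCode o) (opt b ++ .terminal (call c) :: opt z)

variable {A : VPDA C R I Q Γ}

theorem Rule.rightPart {n : ℕ} {β : List (Symbol (Letter C R I) ℕ)} (h : Rule A n β) :
    RightPart (classOf Q) (classOf Q n) β := by
  cases h with
  | S_empty => simpa using RightPart.S_empty
  | S_Y => simpa using RightPart.S_Y _ (by simp)
  | S_call hc hy hz =>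
    simpa using RightPart.S_call _ _ _ (hy.class_eq (by simp)) (hz.class_eq (by simp))
  | Y_segment hβ hy =>
    cases hβ with
    | internal => simpa using RightPart.Y_internal _ _ (hy.class_eq (by simp))
    | call_ret _ _ hb =>
      simpa using RightPart.Y_call_ret _ _ _ _ (hy.class_eq (by simp)) (hb.class_eq (by simp))
  | Y_ret _ hy => simpa using RightPart.Y_ret _ _ (hy.class_eq (by simp))
  | B_segment _ hβ hy =>
    cases hβ with
    | internal => simpa using RightPart.B_internal _ _ (hy.class_eq (by simp))
    | call_ret _ _ hb =>
      simpa using RightPart.B_call_ret _ _ _ _ (hy.class_eq (by simp)) (hb.class_eq (by simp))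
  | Z_segment _ hβ _ hy =>
    cases hβ with
    | internal => simpa using RightPart.Z_internal _ _ (hy.class_eq (by simp))
    | call_ret _ _ hb =>
      simpa using RightPart.Z_call_ret _ _ _ _ (hy.class_eq (by simp)) (hb.class_eq (by simp))
  | Z_call _ _ hb hz =>
    simpa using RightPart.Z_call _ _ _ (hb.class_eq (by simp)) (hz.class_eq (by simp))

theorem Optional.run_Y {q : Q} {y : Option ℕ} {w : List (Letter C R I)}
    (h : Optional (yCode q) (q = A.init) y) (hw : w ∈ expand (meaning A) (opt y)) :
    A.Run (A.init, []) w (q, []) := by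
  rcases h.mem_expand hw with hw | ⟨rfl, rfl⟩
  · simpa using hw
  · exact .nil _

theorem Optional.run_B {p q : Q} {b : Option ℕ} {w : List (Letter C R I)}
    (h : Optional (bCode p q) (p = q) b) (hw : w ∈ expand (meaning A) (opt b)) (σ : List Γ) :
    A.Run (p, σ) w (q, σ) := by
  rcases h.mem_expand hw with hw | ⟨rfl, rfl⟩
  · exact (mem_meaning_bCode A p q w).1 hw σ
  · exact .nil _

theorem Optional.run_Z {p : Q} {z : Option ℕ} {w : List (Letter C R I)}
    (h : Optional (zCode p) (p ∈ A.final) z) (hw : w ∈ expand (meaning A) (opt z))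
    (σ : List Γ) : ∃ q ∈ A.final, ∃ σ', A.Run (p, σ) w (q, σ') := by
  rcases h.mem_expand hw with hw | ⟨rfl, hp⟩
  · exact (mem_meaning_zCode A p w).1 hw σ
  · exact ⟨p, hp, σ, .nil _⟩

theorem Segment.run {q q' : Q} {β : List (Symbol (Letter C R I) ℕ)} {w : List (Letter C R I)}
    (h : Segment A q β q') (hw : w ∈ expand (meaning A) β) (σ : List Γ) :
    A.Run (q, σ) w (q', σ) := by
  cases h with
  | internal h =>
    obtain ⟨_, rfl, rfl⟩ := mem_expand_terminal_cons.1 hw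
    exact (VPDA.Step.internal σ h).run
  | call_ret hc hr hb =>
    obtain ⟨_, hv, rfl⟩ := mem_expand_terminal_cons.1 hw
    obtain ⟨x, hx, _, hy, rfl⟩ := mem_expand_append.1 hv
    obtain ⟨_, rfl, rfl⟩ := mem_expand_terminal_cons.1 hy
    exact .cons (.call σ hc) ((hb.run_B hx _).append (VPDA.Step.pop σ hr).run)

/-- `meaning` speaks of runs alone, with B and Z quantified over all stacks, so each rule reduces to
a concatenation of runs. -/
theorem Rule.sound {n : ℕ} {β : List (Symbol (Letter C R I) ℕ)} (h : Rule A n β) :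
    ∀ w ∈ expand (meaning A) β, w ∈ meaning A n := by
  intro w hw
  cases h with
  | S_empty h =>
    obtain rfl := mem_expand_nil.1 hw
    rw [meaning_sCode]
    exact ⟨_, h, [], .nil _⟩
  | S_Y h =>
    rw [expand_singleton_nonterminal, mem_meaning_yCode] at hw
    rw [meaning_sCode]
    exact ⟨_, h, [], hw⟩
  | S_call hc hy hz =>
    obtain ⟨x, hx, _, hw', rfl⟩ := mem_expand_append.1 hw
    obtain ⟨v, hv, rfl⟩ := mem_expand_terminal_cons.1 hw'
    rw [meaning_sCode]
    obtain ⟨q, hq, σ, hr⟩ := hz.run_Z hv _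
    exact ⟨q, hq, σ, (hy.run_Y hx).append (.cons (.call _ hc) hr)⟩
  | Y_segment hβ hy =>
    obtain ⟨x, hx, v, hv, rfl⟩ := mem_expand_append.1 hw
    rw [mem_meaning_yCode]
    exact (hy.run_Y hx).append (hβ.run hv _)
  | Y_ret hr hy =>
    obtain ⟨x, hx, _, hw', rfl⟩ := mem_expand_append.1 hw
    obtain ⟨_, rfl, rfl⟩ := mem_expand_terminal_cons.1 hw'
    rw [mem_meaning_yCode]
    exact (hy.run_Y hx).append (VPDA.Step.bottom hr).run
  | B_segment _ hβ hb =>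
    obtain ⟨x, hx, v, hv, rfl⟩ := mem_expand_append.1 hw
    rw [mem_meaning_bCode]
    exact fun σ => (hb.run_B hx σ).append (hβ.run hv σ)
  | Z_segment _ hβ hq hb =>
    obtain ⟨x, hx, v, hv, rfl⟩ := mem_expand_append.1 hw
    rw [mem_meaning_zCode]
    exact fun σ => ⟨_, hq, σ, (hb.run_B hx σ).append (hβ.run hv σ)⟩
  | Z_call _ hc hb hz =>
    obtain ⟨x, hx, _, hw', rfl⟩ := mem_expand_append.1 hw
    obtain ⟨v, hv, rfl⟩ := mem_expand_terminal_cons.1 hw'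
    rw [mem_meaning_zCode]
    intro σ
    obtain ⟨q, hq, σ', hr⟩ := hz.run_Z hv _
    exact ⟨q, hq, σ', (hb.run_B hx σ).append (.cons (.call _ hc) hr)⟩

/-! ### Completeness for every family closed under the rules -/

section Completeness

variable {L : ℕ → Language (Letter C R I)}
  (hL : ∀ n β, Rule A n β → ∀ w ∈ expand L β, w ∈ L n)

theorem exists_segment {q t t' q' : Q} {v : List (Letter C R I)} {c : C} {r : R} {Z : Γ}
    (hc : (q, c, t, Z) ∈ A.callTrans) (hr : (t', r, some Z, q') ∈ A.retTrans)
    (hv : v ∈ L (bCode t t') ∨ v = [] ∧ t = t') :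
    ∃ β, Segment A q β q' ∧ call c :: (v ++ [ret r]) ∈ expand L β := by
  obtain ⟨b, hb, hv⟩ := exists_optional hv
  exact ⟨_, .call_ret hc hr hb,
    mem_expand_terminal_cons.2 ⟨_, mem_expand_append.2 ⟨v, hv, _, by simp, rfl⟩, rfl⟩⟩

theorem internal_mem_expand (s : I) :
    [internal s] ∈ expand L [.terminal (internal s : Letter C R I)] := by
  simp

include hL

/-- The rules for `bCode o q` exist only when `o` is the target of a call, which keeps them finite
in number even if `Q` is infinite. The condition propagates: the left part of `w` starts at `o`
again, and the string inside a matched pair starts at the target of its call. -/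
theorem mem_of_balanced {o₀ o q : Q} {c : C} {Z : Γ} {w : List (Letter C R I)}
    (ho : (o₀, c, o, Z) ∈ A.callTrans) (hw : A.Balanced o w q) :
    w ∈ L (bCode o q) ∨ w = [] ∧ o = q := by
  induction hw generalizing o₀ c Z with
  | nil => exact .inr ⟨rfl, rfl⟩
  | internal _ h ih =>
    obtain ⟨b, hb, hw⟩ := exists_optional (ih ho)
    exact .inl (hL _ _ (.B_segment ho (.internal h) hb) _
      (mem_expand_append.2 ⟨_, hw, _, internal_mem_expand _, rfl⟩))
  | call_ret _ hc _ hr ih ih' =>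
    obtain ⟨b, hb, hw⟩ := exists_optional (ih ho)
    obtain ⟨β, hβ, hv⟩ := exists_segment hc hr (ih' hc)
    exact .inl (hL _ _ (.B_segment ho hβ hb) _ (mem_expand_append.2 ⟨_, hw, _, hv, rfl⟩))

/-- There is no rule `Z → B`, so the last segment is split off and generated by a Z-rule, with a B
for what precedes it. -/
theorem mem_of_balanced_final {o₀ o q : Q} {c : C} {Z : Γ} {w : List (Letter C R I)}
    (ho : (o₀, c, o, Z) ∈ A.callTrans) (hw : A.Balanced o w q) (hq : q ∈ A.final) :
    w ∈ L (zCode o) ∨ w = [] ∧ o ∈ A.final := by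
  cases hw with
  | nil => exact .inr ⟨rfl, hq⟩
  | internal hw h =>
    obtain ⟨b, hb, hw⟩ := exists_optional (mem_of_balanced hL ho hw)
    exact .inl (hL _ _ (.Z_segment ho (.internal h) hq hb) _
      (mem_expand_append.2 ⟨_, hw, _, internal_mem_expand _, rfl⟩))
  | call_ret hw hc hv hr =>
    obtain ⟨b, hb, hw⟩ := exists_optional (mem_of_balanced hL ho hw)
    obtain ⟨β, hβ, hv⟩ := exists_segment hc hr (mem_of_balanced hL hc hv)
    exact .inl (hL _ _ (.Z_segment ho hβ hq hb) _ (mem_expand_append.2 ⟨_, hw, _, hv, rfl⟩))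

theorem mem_of_level {q : Q} {w : List (Letter C R I)} (hw : A.Level w q) :
    w ∈ L (yCode q) ∨ w = [] ∧ q = A.init := by
  induction hw with
  | nil => exact .inr ⟨rfl, rfl⟩
  | internal _ h ih =>
    obtain ⟨y, hy, hw⟩ := exists_optional ih
    exact .inl (hL _ _ (.Y_segment (.internal h) hy) _
      (mem_expand_append.2 ⟨_, hw, _, internal_mem_expand _, rfl⟩))
  | bottom _ h ih =>
    obtain ⟨y, hy, hw⟩ := exists_optional ih
    exact .inl (hL _ _ (.Y_ret h hy) _ (mem_expand_append.2 ⟨_, hw, _, by simp, rfl⟩))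
  | call_ret _ hc hv hr ih =>
    obtain ⟨y, hy, hw⟩ := exists_optional ih
    obtain ⟨β, hβ, hv⟩ := exists_segment hc hr (mem_of_balanced hL hc hv)
    exact .inl (hL _ _ (.Y_segment hβ hy) _ (mem_expand_append.2 ⟨_, hw, _, hv, rfl⟩))

/-- Pending calls are peeled off from the last to the first: the balanced string before a call joins
the suffix `z` as a larger Z-string, until the first unmatched call is reached and `S → Y? c Z?`
applies. -/
theorem mem_of_pending {q p : Q} {σ : List Γ} {c : C} {Z : Γ} {w z : List (Letter C R I)}
    (hw : A.Pending w q σ) (hc : (q, c, p, Z) ∈ A.callTrans)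
    (hz : z ∈ L (zCode p) ∨ z = [] ∧ p ∈ A.final) : w ++ call c :: z ∈ L (sCode Q) := by
  induction hw generalizing p c Z z with
  | level h =>
    obtain ⟨y, hy, hw⟩ := exists_optional (mem_of_level hL h)
    obtain ⟨z, hz, hv⟩ := exists_optional hz
    exact hL _ _ (.S_call hc hy hz) _
      (mem_expand_append.2 ⟨_, hw, _, mem_expand_terminal_cons.2 ⟨_, hv, rfl⟩, rfl⟩)
  | call _ hc' hv ih =>
    obtain ⟨b, hb, hw⟩ := exists_optional (mem_of_balanced hL hc' hv)
    obtain ⟨z, hz, hv⟩ := exists_optional hz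
    simpa using ih hc' (.inl (hL _ _ (.Z_call hc' hc hb hz) _
      (mem_expand_append.2 ⟨_, hw, _, mem_expand_terminal_cons.2 ⟨_, hv, rfl⟩, rfl⟩)))

theorem mem_of_mem_language {w : List (Letter C R I)} (hw : w ∈ A.language) :
    w ∈ L (sCode Q) := by
  obtain ⟨q, hq, σ, hr⟩ := hw
  cases VPDA.pending_of_run hr with
  | level h =>
    rcases mem_of_level hL h with h | ⟨rfl, rfl⟩
    · exact hL _ _ (.S_Y hq) _ (by rwa [expand_singleton_nonterminal])
    · exact hL _ _ (.S_empty hq) _ rfl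
  | call hw hc hv => exact mem_of_pending hL hw hc (mem_of_balanced_final hL hc hv hq)

end Completeness

end Construction
-- Listing the rules
section Algorithm

variable {C R I Q Γ : Type} [Primcodable Q]

open Classical in
/-- The optional occurrences of the nonterminal `n`, which may be missing if `P` holds. -/
noncomputable def optionals (n : ℕ) (P : Prop) : List (Option ℕ) :=
  some n :: if P then [none] else []

@[simp] theorem mem_optionals {n : ℕ} {P : Prop} {o : Option ℕ} :
    o ∈ optionals n P ↔ Optional n P o := by
  by_cases hP : P <;> simp [optionals, Optional, hP]

/-- The code of an optional nonterminal. -/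
def optCode {T : Type} (o : Option ℕ) : List (ℕ ⊕ T) := o.toList.map Sum.inl

/-- The string of symbols with a given code. -/
def symbols {T : Type} (l : List (ℕ ⊕ T)) : List (Symbol T ℕ) :=
  l.map (Sum.elim Symbol.nonterminal Symbol.terminal)

@[simp] theorem symbols_optCode {T : Type} (o : Option ℕ) :
    symbols (optCode o : List (ℕ ⊕ T)) = opt o := by
  cases o <;> rfl

@[simp] theorem symbols_append {T : Type} (l l' : List (ℕ ⊕ T)) :
    symbols (l ++ l') = symbols l ++ symbols l' := List.map_append

@[simp] theorem symbols_nil {T : Type} : symbols ([] : List (ℕ ⊕ T)) = [] := rfl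

@[simp] theorem symbols_inr_cons {T : Type} (a : T) (l : List (ℕ ⊕ T)) :
    symbols (.inr a :: l) = .terminal a :: symbols l := rfl

/-- A segment `(q, β, q')`, a string with the states between which it leads. -/
abbrev SegmentCode (C R I Q : Type) : Type := Q × List (ℕ ⊕ Letter C R I) × Q

/-- A rule `(left part, right part)`. -/
abbrev RuleCode (C R I : Type) : Type := ℕ × List (ℕ ⊕ Letter C R I)

open Classical in
/-- The segments of an automaton. -/
noncomputable def segments (A : VPDA C R I Q Γ) : List (SegmentCode C R I Q) :=
  (A.intTrans.map fun t => (t.1, [.inr (internal t.2.1)], t.2.2)) ++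
  A.callTrans.flatMap fun c => A.retTrans.flatMap fun r =>
    if r.2.2.1 = some c.2.2.2 then
      (optionals (bCode c.2.2.1 r.1) (c.2.2.1 = r.1)).map fun b =>
        (c.1, .inr (call c.2.1) :: (optCode b ++ [.inr (ret r.2.1)]), r.2.2.2)
    else []

open Classical in
/-- The segments of an automaton together with the returns that are read on the empty stack. -/
noncomputable def levelSegments (A : VPDA C R I Q Γ) : List (SegmentCode C R I Q) :=
  segments A ++ A.retTrans.flatMap fun r =>
    if r.2.2.1 = none then [(r.1, [.inr (ret r.2.1)], r.2.2.2)] else []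

open Classical in
/-- The rules of class `S`. -/
noncomputable def rulesS (A : VPDA C R I Q Γ) : List (RuleCode C R I) :=
  (if A.init ∈ A.final then [(sCode Q, [])] else []) ++
  (A.final.map fun q => (sCode Q, [.inl (yCode q)])) ++
  A.callTrans.flatMap fun c => (optionals (yCode c.1) (c.1 = A.init)).flatMap fun y =>
    (optionals (zCode c.2.2.1) (c.2.2.1 ∈ A.final)).map fun z =>
      (sCode Q, optCode y ++ .inr (call c.2.1) :: optCode z)

/-- The rules of class `Y`. -/
noncomputable def rulesY (A : VPDA C R I Q Γ) : List (RuleCode C R I) :=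
  (levelSegments A).flatMap fun s => (optionals (yCode s.1) (s.1 = A.init)).map fun y =>
    (yCode s.2.2, optCode y ++ s.2.1)

/-- The rules of class `B`. -/
noncomputable def rulesB (A : VPDA C R I Q Γ) : List (RuleCode C R I) :=
  A.callTrans.flatMap fun c => (segments A).flatMap fun s =>
    (optionals (bCode c.2.2.1 s.1) (c.2.2.1 = s.1)).map fun b =>
      (bCode c.2.2.1 s.2.2, optCode b ++ s.2.1)

open Classical in
/-- The rules of class `Z`. -/
noncomputable def rulesZ (A : VPDA C R I Q Γ) : List (RuleCode C R I) :=
  (A.callTrans.flatMap fun c => (segments A).flatMap fun s =>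
    if s.2.2 ∈ A.final then
      (optionals (bCode c.2.2.1 s.1) (c.2.2.1 = s.1)).map fun b =>
        (zCode c.2.2.1, optCode b ++ s.2.1)
    else []) ++
  A.callTrans.flatMap fun c => A.callTrans.flatMap fun d =>
    (optionals (bCode c.2.2.1 d.1) (c.2.2.1 = d.1)).flatMap fun b =>
      (optionals (zCode d.2.2.1) (d.2.2.1 ∈ A.final)).map fun z =>
        (zCode c.2.2.1, optCode b ++ .inr (call d.2.1) :: optCode z)

/-- The Floyd grammar of an automaton. -/
noncomputable def grammarCode (A : VPDA C R I Q Γ) : GrammarCode (Letter C R I) :=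
  (sCode Q, rulesS A ++ rulesY A ++ rulesB A ++ rulesZ A)

variable {A : VPDA C R I Q Γ}

theorem mem_segments {s : SegmentCode C R I Q} (h : s ∈ segments A) :
    Segment A s.1 (symbols s.2.1) s.2.2 := by
  simp only [segments, List.mem_append, List.mem_map, List.mem_flatMap] at h
  rcases h with ⟨t, ht, rfl⟩ | ⟨c, hc, r, hr, h⟩
  · exact .internal ht
  · split_ifs at h with hZ
    · obtain ⟨b, hb, rfl⟩ := List.mem_map.1 h
      obtain ⟨p', r, X, q'⟩ := r
      obtain rfl : X = _ := hZ
      simpa using Segment.call_ret hc hr (mem_optionals.1 hb)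
    · simp at h

theorem Segment.exists_mem {q q' : Q} {β : List (Symbol (Letter C R I) ℕ)}
    (h : Segment A q β q') : ∃ l, (q, l, q') ∈ segments A ∧ symbols l = β := by
  cases h with
  | @internal _ s h =>
    exact ⟨[.inr (VPFloyd.internal s)], List.mem_append_left _ (List.mem_map.2 ⟨_, h, rfl⟩), rfl⟩
  | @call_ret p p' _ c r Z b hc hr hb =>
    refine ⟨.inr (call c) :: (optCode b ++ [.inr (ret r)]), List.mem_append_right _
      (List.mem_flatMap.2 ⟨_, hc, List.mem_flatMap.2 ⟨_, hr, ?_⟩⟩), by simp⟩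
    rw [if_pos rfl]
    exact List.mem_map.2 ⟨b, mem_optionals.2 hb, rfl⟩

theorem rule_of_mem {ρ : RuleCode C R I} (h : ρ ∈ (grammarCode A).2) :
    Rule A ρ.1 (symbols ρ.2) := by
  simp only [grammarCode, List.mem_append] at h
  rcases h with ((h | h) | h) | h
  · simp only [rulesS, List.mem_append, List.mem_map, List.mem_flatMap, mem_optionals] at h
    rcases h with (h | ⟨q, hq, rfl⟩) | ⟨c, hc, y, hy, z, hz, rfl⟩
    · split_ifs at h with hf
      · obtain rfl := List.mem_singleton.1 h
        exact .S_empty hf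
      · simp at h
    · exact .S_Y hq
    · simpa using Rule.S_call hc hy hz
  · simp only [rulesY, levelSegments, List.mem_append, List.mem_map, List.mem_flatMap,
      mem_optionals] at h
    obtain ⟨s, hs | ⟨r, hr, hs⟩, y, hy, rfl⟩ := h
    · simpa using Rule.Y_segment (mem_segments hs) hy
    · split_ifs at hs with hX
      · obtain rfl := List.mem_singleton.1 hs
        obtain ⟨q, r, X, q'⟩ := r
        obtain rfl : X = none := hX
        simpa using Rule.Y_ret hr hy
      · simp at hs
  · simp only [rulesB, List.mem_map, List.mem_flatMap, mem_optionals] at h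
    obtain ⟨c, hc, s, hs, b, hb, rfl⟩ := h
    simpa using Rule.B_segment hc (mem_segments hs) hb
  · simp only [rulesZ, List.mem_append, List.mem_map, List.mem_flatMap, mem_optionals] at h
    rcases h with ⟨c, hc, s, hs, h⟩ | ⟨c, hc, d, hd, b, hb, z, hz, rfl⟩
    · split_ifs at h with hf
      · obtain ⟨b, hb, rfl⟩ := List.mem_map.1 h
        simpa using Rule.Z_segment hc (mem_segments hs) hf (mem_optionals.1 hb)
      · simp at h
    · simpa using Rule.Z_call hc hd hb hz

theorem Rule.exists_mem {n : ℕ} {β : List (Symbol (Letter C R I) ℕ)} (h : Rule A n β) :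
    ∃ l, (n, l) ∈ (grammarCode A).2 ∧ symbols l = β := by
  simp only [grammarCode, List.mem_append]
  cases h with
  | S_empty h => exact ⟨[], .inl (.inl (.inl (by simp [rulesS, h]))), rfl⟩
  | @S_Y q h => exact ⟨[.inl (yCode q)], .inl (.inl (.inl (by simp [rulesS]; grind))), rfl⟩
  | @S_call q p c Z y z hc hy hz =>
    refine ⟨optCode y ++ .inr (call c) :: optCode z, .inl (.inl (.inl ?_)), by simp⟩
    exact List.mem_append_right _ (List.mem_flatMap.2 ⟨_, hc, List.mem_flatMap.2
      ⟨y, mem_optionals.2 hy, List.mem_map.2 ⟨z, mem_optionals.2 hz, rfl⟩⟩⟩)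
  | @Y_segment q q' β y hβ hy =>
    obtain ⟨l, hl, rfl⟩ := hβ.exists_mem
    exact ⟨optCode y ++ l, .inl (.inl (.inr (List.mem_flatMap.2
      ⟨_, List.mem_append_left _ hl, List.mem_map.2 ⟨y, mem_optionals.2 hy, rfl⟩⟩))), by simp⟩
  | @Y_ret q q' r y hr hy =>
    refine ⟨optCode y ++ [.inr (ret r)], .inl (.inl (.inr (List.mem_flatMap.2
      ⟨(q, [.inr (ret r)], q'), List.mem_append_right _ (List.mem_flatMap.2 ⟨_, hr, ?_⟩),
        List.mem_map.2 ⟨y, mem_optionals.2 hy, rfl⟩⟩))), by simp⟩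
    simp
  | @B_segment o₀ o q q' c Z β b ho hβ hb =>
    obtain ⟨l, hl, rfl⟩ := hβ.exists_mem
    exact ⟨optCode b ++ l, .inl (.inr (List.mem_flatMap.2 ⟨_, ho, List.mem_flatMap.2
      ⟨_, hl, List.mem_map.2 ⟨b, mem_optionals.2 hb, rfl⟩⟩⟩)), by simp⟩
  | @Z_segment o₀ o q q' c Z β b ho hβ hq hb =>
    obtain ⟨l, hl, rfl⟩ := hβ.exists_mem
    refine ⟨optCode b ++ l, .inr (List.mem_append_left _ (List.mem_flatMap.2 ⟨_, ho,
      List.mem_flatMap.2 ⟨_, hl, ?_⟩⟩)), by simp⟩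
    rw [if_pos hq]
    exact List.mem_map.2 ⟨b, mem_optionals.2 hb, rfl⟩
  | @Z_call o₀ o q p c c' Z Z' b z ho hc hb hz =>
    exact ⟨optCode b ++ .inr (call c) :: optCode z, .inr (List.mem_append_right _
      (List.mem_flatMap.2 ⟨_, ho, List.mem_flatMap.2 ⟨_, hc, List.mem_flatMap.2
        ⟨b, mem_optionals.2 hb, List.mem_map.2 ⟨z, mem_optionals.2 hz, rfl⟩⟩⟩⟩)), by simp⟩

theorem mem_rules_toGrammar_iff {T : Type} {g : GrammarCode T} {ρ : ContextFreeRule T ℕ} :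
    ρ ∈ g.toGrammar.rules ↔ ∃ r ∈ g.2, ⟨r.1, symbols r.2⟩ = ρ := by
  -- An arbitrary instance is allowed so that the fact fits the classical one inside `toGrammar`.
  have h {β : Type} (inst : DecidableEq β) (l : List β) (b : β) : b ∈ l.toFinset ↔ b ∈ l :=
    List.mem_toFinset
  exact (h _ _ _).trans List.mem_map

theorem mem_rules_grammarCode {ρ : ContextFreeRule (Letter C R I) ℕ} :
    ρ ∈ (grammarCode A).toGrammar.rules ↔ Rule A ρ.input ρ.output := by
  refine mem_rules_toGrammar_iff.trans ⟨?_, ?_⟩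
  · rintro ⟨ρ, hρ, rfl⟩
    exact rule_of_mem hρ
  · intro h
    obtain ⟨l, hl, hρ⟩ := h.exists_mem
    exact ⟨_, hl, ContextFreeRule.ext rfl hρ⟩

theorem followsFactorization_grammarCode :
    FollowsFactorization (grammarCode A).toGrammar :=
  ⟨classOf Q, classOf_sCode, fun _ hρ => (mem_rules_grammarCode.1 hρ).rightPart⟩

theorem language_grammarCode : (grammarCode A).toGrammar.language = A.language := by
  apply le_antisymm
  · have h := language_le_of_closed (G := (grammarCode A).toGrammar) (L := meaning A)
      fun ρ hρ => (mem_rules_grammarCode.1 hρ).sound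
    exact h.trans_eq (meaning_sCode A)
  · exact fun w hw => mem_of_mem_language (L := yield (grammarCode A).toGrammar)
      (fun n β h w hw => expand_yield_le (G := (grammarCode A).toGrammar) (ρ := ⟨n, β⟩)
        (mem_rules_grammarCode.2 h) hw) hw

end Algorithm

/-! ### The list of rules is primitive recursive -/

section Computability

open Primrec

variable {C R I Q Γ : Type} [Primcodable C] [Primcodable R] [Primcodable I] [Primcodable Q]
  [Primcodable Γ] {α : Type} [Primcodable α]

theorem primrec_init : Primrec (VPDA.init : VPDA C R I Q Γ → Q) :=
  fst.comp (Primrec.of_equiv (e := VPDA.equivTuple))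

theorem primrec_final : Primrec (VPDA.final : VPDA C R I Q Γ → List Q) :=
  (fst.comp snd).comp (Primrec.of_equiv (e := VPDA.equivTuple))

theorem primrec_callTrans :
    Primrec (VPDA.callTrans : VPDA C R I Q Γ → List (Q × C × Q × Γ)) :=
  (fst.comp (snd.comp snd)).comp (Primrec.of_equiv (e := VPDA.equivTuple))

theorem primrec_retTrans :
    Primrec (VPDA.retTrans : VPDA C R I Q Γ → List (Q × R × Option Γ × Q)) :=
  (fst.comp (snd.comp (snd.comp snd))).comp (Primrec.of_equiv (e := VPDA.equivTuple))

theorem primrec_intTrans : Primrec (VPDA.intTrans : VPDA C R I Q Γ → List (Q × I × Q)) :=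
  (snd.comp (snd.comp (snd.comp snd))).comp (Primrec.of_equiv (e := VPDA.equivTuple))

theorem primrec_yCode : Primrec (yCode : Q → ℕ) :=
  Primrec.encode.comp (option_some.comp sumInl)

theorem primrec_bCode : Primrec₂ (bCode : Q → Q → ℕ) :=
  Primrec.encode.comp (option_some.comp (sumInr.comp (sumInl.comp (fst.pair snd))))

theorem primrec_zCode : Primrec (zCode : Q → ℕ) :=
  Primrec.encode.comp (option_some.comp (sumInr.comp sumInr))

-- The classical case distinction in `optionals` is harmless: the conditions used are equality of
-- states and membership in the list of final states, both primitive recursive.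
open Classical in
theorem primrec_optionals {f : α → ℕ} {P : α → Prop} (hf : Primrec f) (hP : PrimrecPred P) :
    Primrec fun a => optionals (f a) (P a) :=
  list_cons.comp (option_some.comp hf) (Primrec.ite hP (const _) (const _))

theorem primrecPred_mem {f : α → Q} {l : α → List Q} (hf : Primrec f) (hl : Primrec l) :
    PrimrecPred fun a => f a ∈ l a :=
  (Primrec.eq.exists_mem_list.comp hl hf).of_eq (by simp)

theorem primrec_optCode {T : Type} [Primcodable T] :
    Primrec (optCode : Option ℕ → List (ℕ ⊕ T)) :=
  list_map optionToList (sumInl.comp snd)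

theorem primrec_list_singleton {β : Type} [Primcodable β] : Primrec fun b : β => [b] :=
  list_cons.comp .id (const [])

theorem primrec_call : Primrec fun c : C => (.inr (call c) : ℕ ⊕ Letter C R I) :=
  sumInr.comp sumInl

theorem primrec_ret : Primrec fun r : R => (.inr (ret r) : ℕ ⊕ Letter C R I) :=
  sumInr.comp (sumInr.comp sumInl)

theorem primrec_internal : Primrec fun s : I => (.inr (internal s) : ℕ ⊕ Letter C R I) :=
  sumInr.comp (sumInr.comp sumInr)

-- Nested maps carry their variables as nested pairs, here `(((A, c), r), b)`; the chains of `fst`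
-- and `snd` select from them.
open Classical in
theorem primrec_segments : Primrec (segments : VPDA C R I Q Γ → List (SegmentCode C R I Q)) := by
  refine list_append.comp (list_map primrec_intTrans (Primrec.pair (fst.comp snd) (Primrec.pair
    (primrec_list_singleton.comp (primrec_internal.comp (fst.comp (snd.comp snd))))
    (snd.comp (snd.comp snd))))) (list_flatMap primrec_callTrans (list_flatMap
      (primrec_retTrans.comp fst) (Primrec.ite ?_ (list_map (primrec_optionals ?_ ?_) ?_)
        (const []))))
  · exact Primrec.eq.comp (fst.comp (snd.comp (snd.comp snd)))
      (option_some.comp (snd.comp (snd.comp (snd.comp (snd.comp fst)))))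
  · exact primrec_bCode.comp (fst.comp (snd.comp (snd.comp (snd.comp fst)))) (fst.comp snd)
  · exact Primrec.eq.comp (fst.comp (snd.comp (snd.comp (snd.comp fst)))) (fst.comp snd)
  · exact Primrec.pair (fst.comp (snd.comp (fst.comp fst))) (Primrec.pair
      (list_cons.comp (primrec_call.comp (fst.comp (snd.comp (snd.comp (fst.comp fst)))))
        (list_append.comp (primrec_optCode.comp snd) (primrec_list_singleton.comp
          (primrec_ret.comp (fst.comp (snd.comp (snd.comp fst)))))))
      (snd.comp (snd.comp (snd.comp (snd.comp fst)))))

open Classical in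
theorem primrec_levelSegments :
    Primrec (levelSegments : VPDA C R I Q Γ → List (SegmentCode C R I Q)) := by
  refine list_append.comp primrec_segments (list_flatMap primrec_retTrans
    (Primrec.ite ?_ (primrec_list_singleton.comp ?_) (const [])))
  · exact Primrec.eq.comp (fst.comp (snd.comp (snd.comp snd))) (const none)
  · exact Primrec.pair (fst.comp snd) (Primrec.pair (primrec_list_singleton.comp
      (primrec_ret.comp (fst.comp (snd.comp snd)))) (snd.comp (snd.comp (snd.comp snd))))

open Classical in
theorem primrec_rulesS : Primrec (rulesS : VPDA C R I Q Γ → List (RuleCode C R I)) := by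
  refine list_append.comp (list_append.comp
    (Primrec.ite (primrecPred_mem primrec_init primrec_final) (const _) (const _))
    (list_map primrec_final (Primrec.pair (const _) (primrec_list_singleton.comp
      (sumInl.comp (primrec_yCode.comp snd))))))
    (list_flatMap primrec_callTrans (list_flatMap (primrec_optionals
      (primrec_yCode.comp (fst.comp snd))
      (Primrec.eq.comp (fst.comp snd) (primrec_init.comp fst)))
      (list_map (primrec_optionals ?_ (primrecPred_mem ?_ ?_)) (Primrec.pair (const _) ?_))))
  · exact primrec_zCode.comp (fst.comp (snd.comp (snd.comp (snd.comp fst))))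
  · exact fst.comp (snd.comp (snd.comp (snd.comp fst)))
  · exact primrec_final.comp (fst.comp fst)
  · exact list_append.comp (primrec_optCode.comp (snd.comp fst)) (list_cons.comp
      (primrec_call.comp (fst.comp (snd.comp (snd.comp (fst.comp fst)))))
      (primrec_optCode.comp snd))

theorem primrec_rulesY : Primrec (rulesY : VPDA C R I Q Γ → List (RuleCode C R I)) := by
  refine list_flatMap primrec_levelSegments (list_map (primrec_optionals
    (primrec_yCode.comp (fst.comp snd))
    (Primrec.eq.comp (fst.comp snd) (primrec_init.comp fst))) (Primrec.pair ?_ ?_))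
  · exact primrec_yCode.comp (snd.comp (snd.comp (snd.comp fst)))
  · exact list_append.comp (primrec_optCode.comp snd) (fst.comp (snd.comp (snd.comp fst)))

theorem primrec_rulesB : Primrec (rulesB : VPDA C R I Q Γ → List (RuleCode C R I)) := by
  refine list_flatMap primrec_callTrans (list_flatMap (primrec_segments.comp fst)
    (list_map (primrec_optionals ?_ ?_) (Primrec.pair ?_ ?_)))
  · exact primrec_bCode.comp (fst.comp (snd.comp (snd.comp (snd.comp fst)))) (fst.comp snd)
  · exact Primrec.eq.comp (fst.comp (snd.comp (snd.comp (snd.comp fst)))) (fst.comp snd)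
  · exact primrec_bCode.comp (fst.comp (snd.comp (snd.comp (snd.comp (fst.comp fst)))))
      (snd.comp (snd.comp (snd.comp fst)))
  · exact list_append.comp (primrec_optCode.comp snd) (fst.comp (snd.comp (snd.comp fst)))

open Classical in
theorem primrec_rulesZ : Primrec (rulesZ : VPDA C R I Q Γ → List (RuleCode C R I)) := by
  refine list_append.comp (list_flatMap primrec_callTrans (list_flatMap
    (primrec_segments.comp fst) (Primrec.ite (primrecPred_mem ?_ ?_)
      (list_map (primrec_optionals ?_ ?_) (Primrec.pair ?_ ?_)) (const []))))
    (list_flatMap primrec_callTrans (list_flatMap (primrec_callTrans.comp fst)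
      (list_flatMap (primrec_optionals ?_ ?_) (list_map
        (primrec_optionals ?_ (primrecPred_mem ?_ ?_)) (Primrec.pair ?_ ?_)))))
  · exact snd.comp (snd.comp snd)
  · exact primrec_final.comp (fst.comp fst)
  · exact primrec_bCode.comp (fst.comp (snd.comp (snd.comp (snd.comp fst)))) (fst.comp snd)
  · exact Primrec.eq.comp (fst.comp (snd.comp (snd.comp (snd.comp fst)))) (fst.comp snd)
  · exact primrec_zCode.comp (fst.comp (snd.comp (snd.comp (snd.comp (fst.comp fst)))))
  · exact list_append.comp (primrec_optCode.comp snd) (fst.comp (snd.comp (snd.comp fst)))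
  · exact primrec_bCode.comp (fst.comp (snd.comp (snd.comp (snd.comp fst)))) (fst.comp snd)
  · exact Primrec.eq.comp (fst.comp (snd.comp (snd.comp (snd.comp fst)))) (fst.comp snd)
  · exact primrec_zCode.comp (fst.comp (snd.comp (snd.comp (snd.comp fst))))
  · exact fst.comp (snd.comp (snd.comp (snd.comp fst)))
  · exact primrec_final.comp (fst.comp (fst.comp fst))
  · exact primrec_zCode.comp
      (fst.comp (snd.comp (snd.comp (snd.comp (fst.comp (fst.comp fst))))))
  · exact list_append.comp (primrec_optCode.comp (snd.comp fst)) (list_cons.comp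
      (primrec_call.comp (fst.comp (snd.comp (snd.comp (fst.comp fst)))))
      (primrec_optCode.comp snd))

theorem primrec_grammarCode :
    Primrec (grammarCode : VPDA C R I Q Γ → GrammarCode (Letter C R I)) :=
  Primrec.pair (const _) (list_append.comp (list_append.comp (list_append.comp primrec_rulesS
    primrec_rulesY) primrec_rulesB) primrec_rulesZ)

end Computability

end VPFloyd

/-- There is an algorithm that turns every visibly pushdown automaton into an equivalent Floyd
grammar whose precedence matrix is contained in the total VP matrix and whose rules follow the
factorization of the accepted strings.  An automaton mentions only finitely many letters, states
and stack symbols; with all five types equal to `ℕ` the algorithm is uniform in all of them. -/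
theorem mainTheorem1 (C R I Q Γ : Type) [Primcodable C] [Primcodable R] [Primcodable I]
    [Primcodable Q] [Primcodable Γ] :
    ∃ f : VPFloyd.VPDA C R I Q Γ → VPFloyd.GrammarCode (VPFloyd.Letter C R I),
      Computable f ∧
      ∀ A : VPFloyd.VPDA C R I Q Γ,
        VPFloyd.IsFloydGrammar (f A).toGrammar ∧
        (f A).toGrammar.language = A.language ∧
        VPFloyd.opm (f A).toGrammar ≤ VPFloyd.totalVPMatrix ∧
        VPFloyd.FollowsFactorization (f A).toGrammar :=
  ⟨VPFloyd.grammarCode, VPFloyd.primrec_grammarCode.to_comp, fun _ =>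
    ⟨VPFloyd.followsFactorization_grammarCode.isFloydGrammar, VPFloyd.language_grammarCode,
      VPFloyd.followsFactorization_grammarCode.opm_le, VPFloyd.followsFactorization_grammarCode⟩⟩
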